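/- **Definitions.** Let $E\subseteq\mathbb R^2$ (the environment). A point $y$ is visible from $x$ in $E$ if the line segment $xy$ is contained in $E$; write $\mathrm{VP}(x)$ for the set of points visible from $x$. Let $X$ be a set of points and let $C$ be a curve in $E$ traced by a continuous path $\gamma:[0,1]\to E$. The pair $(X,C)$ is *chain-visible* in $E$ if for every $x\in X$ the set $\mathrm{VP}(x)\cap C$ is either empty or a connected chain of $C$, i.e. of the form $\gamma([t_0,t_1])$ with $0\le t_0\le t_1\le 1$. A *simple polygon* (polygon without holes) is the closed region consisting of a simple closed polygonal curve with at least three vertices together with the points it encloses. A *street polygon* is a simple polygon whose boundary can be divided at two points $s\ne t$ into two chains $U$ and $D$ from $s$ to $t$ such that every point of $U$ is visible, within the polygon, from some point of $D$ and vice versa. A *watchman route* in $E$ is a closed curve in $E$ such that every point of $E$ is visible from some point of the curve. A path $\gamma$ of finite length from $a$ to $b$ is a *collapsed watchman route* if the closed curve that follows $\gamma$ from $a$ to $b$ and returns along $\gamma$ to $a$ is a watchman route and is shortest among all watchman routes passing through $a$ and $b$. A *shortest path* from $s$ to $t$ in $E$ is a path of finite length from $s$ to $t$ in $E$ whose length is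 minimal among all paths from $s$ to $t$ in $E$. A *1.5D terrain* is the graph $\{(x,f(x)):x\in I\}$ of a continuous function $f:I\to\mathbb R$ on an interval $I\subseteq\mathbb R$; its environment is $\{(x,y):x\in I,\ y\ge f(x)\}$. A *fixed-altitude path* is a path in this environment along which the $y$-coordinate is constant. **Proposition.** The following pairs $(X,C)$ are chain-visible: 1. $X$ is any set of points in a street polygon $P$, and $C$ is a collapsed watchman route in $P$ (with environment $P$). 2. $X$ is any set of points in a simple polygon $P$, and $C$ is a shortest path in $P$ between two points $s,t\in P$ (with environment $P$). In particular, $C$ can be any straight line segment contained in $P$. 3. $X$ is any set of points on a 1.5D terrain, and $C$ is a fixed-altitude path (with the environment of the terrain). -/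

import Mathlib

open Set

/-- The Euclidean plane. -/
abbrev Plane := EuclideanSpace ℝ (Fin 2)

/-! ### Visibility and chain-visibility -/

/-- The part of the environment `E` that is visible from `x` (the visibility polygon of `x`, when
`E` is a polygon): the points `y` for which the line segment from `x` to `y` stays inside `E`. -/
def visibilityRegion (E : Set Plane) (x : Plane) : Set Plane :=
  {y | segment ℝ x y ⊆ E}

/-- `(X, C)` is chain-visible in the environment `E`, where `C` is the curve traced by the path `γ`:
for every `x ∈ X`, the part of `C` visible from `x` is either empty or a connected chain of `C`,
that is, the piece of `C` traced by `γ` during some closed parameter interval. -/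
def ChainVisible (E X : Set Plane) {a b : Plane} (γ : Path a b) : Prop :=
  ∀ x ∈ X, visibilityRegion E x ∩ range γ = ∅ ∨
    ∃ t₀ t₁ : unitInterval, t₀ ≤ t₁ ∧ visibilityRegion E x ∩ range γ = γ '' Icc t₀ t₁

/-! ### Paths and routes -/

/-- The length of a path, in `[0, ∞]`: the supremum of the lengths of inscribed polygonal paths. -/
noncomputable def pathLength {a b : Plane} (γ : Path a b) : ENNReal :=
  eVariationOn γ univ

/-- `γ` is a shortest path from `a` to `b` inside the environment `E`. -/
structure IsShortestPath (E : Set Plane) {a b : Plane} (γ : Path a b) : Prop where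
  subset : range γ ⊆ E
  rectifiable : pathLength γ ≠ ⊤
  minimal : ∀ σ : Path a b, range σ ⊆ E → pathLength γ ≤ pathLength σ

/-- A watchman route in `E`: a closed curve inside `E` such that every point of `E` is visible from
some point of the curve. -/
structure IsWatchmanRoute (E : Set Plane) {p : Plane} (w : Path p p) : Prop where
  subset : range w ⊆ E
  sees : ∀ x ∈ E, ∃ y ∈ range w, y ∈ visibilityRegion E x

/-- The path `γ` from `a` to `b` is a collapsed watchman route in `E`: the closed curve that follows
`γ` from `a` to `b` and then returns along `γ` to `a` is a watchman route, and it is shortest among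
all watchman routes through `a` and `b`. (In particular, whenever a watchman route that is shortest
among all watchman routes is of this back-and-forth form, `γ` is a collapsed watchman route.) -/
structure IsCollapsedWatchmanRoute (E : Set Plane) {a b : Plane} (γ : Path a b) : Prop where
  isWatchmanRoute : IsWatchmanRoute E (γ.trans γ.symm)
  rectifiable : pathLength γ ≠ ⊤
  minimal : ∀ (p : Plane) (w : Path p p), IsWatchmanRoute E w → a ∈ range w → b ∈ range w →
    pathLength (γ.trans γ.symm) ≤ pathLength w

/-! ### Polygons without holes, and street polygons -/

/-- The closed polygonal curve with the given cyclic sequence of vertices is simple: there are at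
least three vertices, they are distinct, and two different edges meet at most in a common
endpoint. -/
structure IsSimplePolygon {n : ℕ} (Q : Polygon Plane n) : Prop where
  three_le : 3 ≤ n
  injective : Function.Injective Q.vertices
  edges : ∀ i j : Fin n, i ≠ j → Q.edgeSet ℝ i ∩ Q.edgeSet ℝ j ⊆
    {Q i, Q (finRotate n i)} ∩ {Q j, Q (finRotate n j)}

/-- The closed region bounded by the polygonal curve: its boundary together with the points enclosed
by it, i.e. those lying in a bounded connected component of the complement of the boundary. -/
def polygonRegion {n : ℕ} (Q : Polygon Plane n) : Set Plane :=
  Q.boundary ℝ ∪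
    {p | p ∉ Q.boundary ℝ ∧ Bornology.IsBounded (connectedComponentIn (Q.boundary ℝ)ᶜ p)}

/-- A street polygon: a simple polygon whose boundary splits, at two points `s ≠ t`, into two chains
`U` and `D` from `s` to `t` such that every point of `U` is visible (inside the polygon) from some
point of `D`, and vice versa. -/
def IsStreetPolygon {n : ℕ} (Q : Polygon Plane n) : Prop :=
  IsSimplePolygon Q ∧ ∃ (s t : Plane) (U D : Path s t), s ≠ t ∧
    Function.Injective U ∧ Function.Injective D ∧
    range U ∪ range D = Q.boundary ℝ ∧ range U ∩ range D = {s, t} ∧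
    (∀ u ∈ range U, ∃ d ∈ range D, u ∈ visibilityRegion (polygonRegion Q) d) ∧
    (∀ d ∈ range D, ∃ u ∈ range U, d ∈ visibilityRegion (polygonRegion Q) u)

/-! ### Terrains -/

/-- The environment of the 1.5D terrain of height function `f` over `I`: all the points of the
vertical strip over `I` that lie on or above the terrain. -/
def terrainEnvironment (I : Set ℝ) (f : ℝ → ℝ) : Set Plane :=
  {p | p 0 ∈ I ∧ f (p 0) ≤ p 1}

/-- The terrain itself, i.e. the graph of `f` over `I`. -/
def terrainSurface (I : Set ℝ) (f : ℝ → ℝ) : Set Plane :=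
  {p | p 0 ∈ I ∧ p 1 = f (p 0)}

/-- The path `γ` stays at one fixed altitude. -/
def IsFixedAltitudePath {a b : Plane} (γ : Path a b) : Prop :=
  ∃ h : ℝ, ∀ t, γ t 1 = h

/-!
A polygon without holes enters the proof only through two properties of its region `P`: it is
closed, and every point outside it can be led away to infinity inside the complement (`HoleFree`).
Hence whatever is enclosed by a subset of `P` belongs to `P`.

Let `γ` be a shortest path in `P`, let `V` be the region visible from `x`, and consider an excursion
of `γ` out of `V`, leaving at `p` and returning at `q`. Then `p` and `q` lie on one ray from `x`
(`sameRay_of_forall_visible_eq`). Otherwise the closed curve `K` formed by `[x, p]`, the excursion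
and `[q, x]` encloses the points close to the midpoint of `[x, p]` on at least one side. A ray from
`x` through such a point stays in `P` until it hits `K`; the hit is on the excursion, and it is
visible from `x`, which is absurd. So `[p, q]` is contained in the ray and in `V`, and a shortest
path follows it instead of leaving `V` (`IsShortestPath.mem_segment`). Therefore the times at which
`γ` is in `V` form a closed interval.

That `K` separates the two sides of `[x, p]` is proved with logarithms instead of the Jordan curve
theorem. If `z₁` and `z₂`, just off the midpoint on either side, both could be led away to infinity
off `K`, then `w ↦ w - z₁` and `w ↦ w - z₂` would have continuous logarithms on `K`
(`exists_continuousOn_log_sub`). Their difference would agree, up to a constant, with the principal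
logarithm of `(w - z₁) / (w - z₂)` on the connected set `K` minus the midpoint, and that one jumps
by `2πi` at the midpoint (`not_exists_log_sub_and_exists_log_sub`).

A collapsed watchman route is a shortest path between its endpoints, because following it forth and
any other path back gives a watchman route (`IsCollapsedWatchmanRoute.isShortestPath`); a segment
is a shortest path too. Over a terrain, a point that sees two points of a fixed-altitude path sees
everything between them at that altitude (`mem_visibilityRegion_terrainEnvironment`).
-/

/-! ### Sets without holes -/

/-- A set has no holes if each point outside it can be led away to infinity without meeting it,
that is, lies in an unbounded connected set that is disjoint from it. -/
def HoleFree {E : Type*} [NormedAddCommGroup E] (P : Set E) : Prop :=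
  ∀ z ∉ P, ∃ W : Set E, IsPreconnected W ∧ z ∈ W ∧ ¬ Bornology.IsBounded W ∧ Disjoint W P

/-- Let `K` be a closed set inside a set `P` without holes. If `K` encloses `x + v` and the segment
from `x` to `x + v` misses `K`, then the first point where the ray from `x` through `x + v` hits `K`
is visible from `x`: up to there the ray runs through points enclosed by `K`, which are in `P`. -/
theorem HoleFree.exists_mem_ray_segment_subset {E : Type*} [NormedAddCommGroup E]
    [NormedSpace ℝ E] {P K : Set E} (hH : HoleFree P) (hK : IsClosed K)
    (hKP : K ⊆ P) {x v : E} (hx : x ∈ P) (hv : v ≠ 0)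
    (henc : ∀ W : Set E, IsPreconnected W → x + v ∈ W → Disjoint W K → Bornology.IsBounded W)
    (hfree : ∀ t ∈ Ioc (0 : ℝ) 1, x + t • v ∉ K) :
    ∃ s > (0 : ℝ), x + s • v ∈ K ∧ segment ℝ x (x + s • v) ⊆ P := by
  have hcont : Continuous fun t : ℝ => x + t • v := by fun_prop
  have hhit : ((fun t : ℝ => x + t • v) ⁻¹' K ∩ Ici 1).Nonempty := by
    by_contra hne
    rw [not_nonempty_iff_eq_empty] at hne
    have hb := henc ((fun t : ℝ => x + t • v) '' Ioi 0)
      (isPreconnected_Ioi.image _ hcont.continuousOn) ⟨1, by simp, by simp⟩ (by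
        rw [disjoint_left]
        rintro _ ⟨t, ht, rfl⟩ htK
        rcases le_total t 1 with h1 | h1
        · exact hfree t ⟨ht, h1⟩ htK
        · exact (hne ▸ (⟨htK, h1⟩ : t ∈ (fun t : ℝ => x + t • v) ⁻¹' K ∩ Ici 1) : t ∈ (∅ : Set ℝ)))
    obtain ⟨C, hC⟩ := hb.exists_norm_le
    have hvpos : 0 < ‖v‖ := norm_pos_iff.2 hv
    have hCx : 0 ≤ C + ‖x‖ := by
      have := hC _ ⟨1, by simp, rfl⟩
      have := norm_nonneg (x + (1 : ℝ) • v)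
      have := norm_nonneg x
      linarith
    have h1 := hC _ ⟨(C + ‖x‖ + 1) / ‖v‖, div_pos (by linarith) hvpos, rfl⟩
    have h2 : ‖((C + ‖x‖ + 1) / ‖v‖) • v‖ = C + ‖x‖ + 1 := by
      rw [norm_smul, Real.norm_of_nonneg (by positivity)]
      field_simp
    have h3 := norm_sub_le (x + ((C + ‖x‖ + 1) / ‖v‖) • v) x
    rw [add_sub_cancel_left, h2] at h3
    dsimp only at h1
    linarith
  -- The first hit is at parameter `s`.
  set A := (fun t : ℝ => x + t • v) ⁻¹' K ∩ Ici 1 with hA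
  have hAc : IsClosed A := (hK.preimage hcont).inter isClosed_Ici
  have hAb : BddBelow A := ⟨1, fun t ht => ht.2⟩
  have hs := hAc.csInf_mem hhit hAb
  set s := sInf A
  have hs1 : 1 < s := by
    refine lt_of_le_of_ne hs.2 fun h => hfree 1 (by simp) ?_
    rw [h]; exact hs.1
  have hfree' : ∀ t ∈ Ioo (0 : ℝ) s, x + t • v ∉ K := by
    intro t ht htK
    rcases le_total t 1 with h1 | h1
    · exact hfree t ⟨ht.1, h1⟩ htK
    · exact absurd (csInf_le hAb ⟨htK, h1⟩) (not_le.2 ht.2)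
  have hin : ∀ t ∈ Ioo (0 : ℝ) s, x + t • v ∈ P := by
    intro t ht
    by_contra hnP
    obtain ⟨W, hWc, htW, hWb, hWP⟩ := hH _ hnP
    refine hWb ((henc (W ∪ (fun t : ℝ => x + t • v) '' Ioo 0 s) ?_ ?_ ?_).subset
      subset_union_left)
    · exact hWc.union _ htW ⟨t, ht, rfl⟩ (isPreconnected_Ioo.image _ hcont.continuousOn)
    · exact Or.inr ⟨1, ⟨by simp, hs1⟩, by simp⟩
    · rw [disjoint_union_left]
      refine ⟨hWP.mono_right hKP, disjoint_left.2 ?_⟩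
      rintro _ ⟨t, ht, rfl⟩ htK
      exact hfree' t ht htK
  refine ⟨s, by linarith, hs.1, ?_⟩
  rw [segment_eq_image']
  rintro _ ⟨t, ht, rfl⟩
  simp only [add_sub_cancel_left, smul_smul]
  rcases ht.1.eq_or_lt with h0 | h0
  · simpa [← h0] using hx
  rcases ht.2.eq_or_lt with h1 | h1
  · rw [h1, one_mul]; exact hKP hs.1
  · exact hin _ ⟨by positivity, by nlinarith⟩

/-! ### Continuous logarithms and separation of the plane -/

/-- If `z` can be led away to infinity without meeting the compact set `K`, then `w ↦ w - z` has a
continuous logarithm on `K`. -/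
theorem exists_continuousOn_log_sub {K W : Set ℂ} (hK : IsCompact K) (hW : IsPreconnected W)
    (hWb : ¬ Bornology.IsBounded W) (hWK : Disjoint W K) {z : ℂ} (hz : z ∈ W) :
    ∃ g : ℂ → ℂ, ContinuousOn g K ∧ ∀ w ∈ K, Complex.exp (g w) = w - z := by
  -- Passing from `a` to a nearby point `b` multiplies by `(w - b) / (w - a)`, which stays in the
  -- domain of the principal logarithm.
  have key : ∀ a b : ℂ, (∀ w ∈ K, ‖b - a‖ < ‖w - a‖) →
      ((∃ g : ℂ → ℂ, ContinuousOn g K ∧ ∀ w ∈ K, Complex.exp (g w) = w - a) ↔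
        ∃ g : ℂ → ℂ, ContinuousOn g K ∧ ∀ w ∈ K, Complex.exp (g w) = w - b) := by
    intro a b hab
    have hne : ∀ w ∈ K, w - a ≠ 0 := fun w hw h => by
      have := hab w hw
      rw [h, norm_zero] at this
      exact absurd this (not_lt.2 (norm_nonneg _))
    have hsl : ∀ w ∈ K, (w - b) / (w - a) ∈ Complex.slitPlane := by
      intro w hw
      have h1 : (w - b) / (w - a) = 1 + -((b - a) / (w - a)) := by
        have := hne w hw
        field_simp
        ring
      rw [h1]
      apply Complex.mem_slitPlane_of_norm_lt_one
      rw [norm_neg, norm_div, div_lt_one (norm_pos_iff.2 (hne w hw))]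
      exact hab w hw
    have hlog : ContinuousOn (fun w => Complex.log ((w - b) / (w - a))) K := by
      refine ContinuousOn.clog (ContinuousOn.div (by fun_prop) (by fun_prop) hne) hsl
    have hexp : ∀ w ∈ K, Complex.exp (Complex.log ((w - b) / (w - a))) = (w - b) / (w - a) :=
      fun w hw => Complex.exp_log (Complex.slitPlane_ne_zero (hsl w hw))
    constructor
    · rintro ⟨g, hg, hge⟩
      refine ⟨fun w => g w + Complex.log ((w - b) / (w - a)), hg.add hlog, fun w hw => ?_⟩
      rw [Complex.exp_add, hge w hw, hexp w hw, mul_div_cancel₀ _ (hne w hw)]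
    · rintro ⟨g, hg, hge⟩
      refine ⟨fun w => g w - Complex.log ((w - b) / (w - a)), hg.sub hlog, fun w hw => ?_⟩
      have h0 := Complex.slitPlane_ne_zero (hsl w hw)
      have h1 := hne w hw
      rw [Complex.exp_sub, hge w hw, hexp w hw]
      have h2 : w - b ≠ 0 := fun h => h0 (by rw [h, zero_div])
      field_simp
  obtain ⟨C, hC⟩ := hK.isBounded.exists_norm_le
  obtain ⟨z', hz', hz'C⟩ : ∃ z' ∈ W, C < ‖z'‖ := by
    by_contra! h
    exact hWb (isBounded_iff_forall_norm_le.2 ⟨C, h⟩)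
  -- For `z'` far away, `w - z' = -z' * (1 - w / z')` is a product of two principal cases.
  have hfar : ∃ g : ℂ → ℂ, ContinuousOn g K ∧ ∀ w ∈ K, Complex.exp (g w) = w - z' := by
    by_cases hKe : K = ∅
    · exact ⟨0, by simp [hKe], by simp [hKe]⟩
    obtain ⟨w₀, hw₀⟩ := nonempty_iff_ne_empty.2 hKe
    have hz'0 : z' ≠ 0 := norm_pos_iff.1 (((norm_nonneg _).trans (hC w₀ hw₀)).trans_lt hz'C)
    have hsl : ∀ w ∈ K, 1 + -(w / z') ∈ Complex.slitPlane := by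
      intro w hw
      apply Complex.mem_slitPlane_of_norm_lt_one
      rw [norm_neg, norm_div, div_lt_one (norm_pos_iff.2 hz'0)]
      exact (hC w hw).trans_lt hz'C
    refine ⟨fun w => Complex.log (-z') + Complex.log (1 + -(w / z')),
      continuousOn_const.add (ContinuousOn.clog (by fun_prop) hsl), fun w hw => ?_⟩
    rw [Complex.exp_add, Complex.exp_log (neg_ne_zero.2 hz'0),
      Complex.exp_log (Complex.slitPlane_ne_zero (hsl w hw))]
    field_simp
    ring
  refine (hW.induction₂' (fun a b =>
      ((∃ g : ℂ → ℂ, ContinuousOn g K ∧ ∀ w ∈ K, Complex.exp (g w) = w - a) ↔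
        ∃ g : ℂ → ℂ, ContinuousOn g K ∧ ∀ w ∈ K, Complex.exp (g w) = w - b)) ?_ ?_ hz' hz).1 hfar
  · intro a ha
    have haK : a ∈ Kᶜ := disjoint_left.1 hWK ha
    obtain ⟨r, hr, hrK⟩ := Metric.isOpen_iff.1 hK.isClosed.isOpen_compl a haK
    filter_upwards [mem_nhdsWithin_of_mem_nhds (Metric.ball_mem_nhds a hr)] with b hb
    have := key a b fun w hw => by
      rw [← dist_eq_norm, ← dist_eq_norm]
      refine (Metric.mem_ball.1 hb).trans_le (not_lt.1 fun h => hrK (Metric.mem_ball.2 h) hw)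
    exact ⟨this, this.symm⟩
  · intro a b c _ _ _ h1 h2
    exact h1.trans h2

/-- On a set that crosses the short segment from `z₁` to `z₂` only at its midpoint, and stays
connected when that point is removed, `w ↦ w - z₁` and `w ↦ w - z₂` do not both have a continuous
logarithm: the principal logarithm of the quotient jumps by `2πi` at the midpoint. -/
theorem not_exists_log_sub_and_exists_log_sub {K : Set ℂ} {x d : ℂ} (hd : d ≠ 0) {ε : ℝ}
    (hε : 0 < ε) (hseg : ∀ s ∈ Icc (0 : ℝ) 1, x + s * d ∈ K)
    (hmid : ∀ τ ∈ Icc (-ε) ε, x + (1 / 2 + τ * Complex.I) * d ∈ K → τ = 0)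
    (hconn : IsPreconnected (K \ {x + 1 / 2 * d}))
    (h₁ : ∃ g : ℂ → ℂ, ContinuousOn g K ∧
      ∀ w ∈ K, Complex.exp (g w) = w - (x + (1 / 2 + ε * Complex.I) * d))
    (h₂ : ∃ g : ℂ → ℂ, ContinuousOn g K ∧
      ∀ w ∈ K, Complex.exp (g w) = w - (x + (1 / 2 - ε * Complex.I) * d)) : False := by
  obtain ⟨g₁, hg₁, he₁⟩ := h₁
  obtain ⟨g₂, hg₂, he₂⟩ := h₂
  have hquot : ∀ u : ℂ, (x + (u + 1 / 2) * d - (x + (1 / 2 + ε * Complex.I) * d)) /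
      (x + (u + 1 / 2) * d - (x + (1 / 2 - ε * Complex.I) * d)) =
      (u - ε * Complex.I) / (u + ε * Complex.I) := by
    intro u
    rw [← mul_div_mul_right (u - ε * Complex.I) (u + ε * Complex.I) hd]
    congr 1 <;> ring
  have hre : ∀ u : ℂ, ((u - ε * Complex.I) / (u + ε * Complex.I)).re =
      (u.re ^ 2 + u.im ^ 2 - ε ^ 2) / Complex.normSq (u + ε * Complex.I) := by
    intro u
    simp only [Complex.div_re, Complex.sub_re, Complex.add_re, Complex.sub_im, Complex.add_im,
      Complex.re_ofReal_mul, Complex.im_ofReal_mul, Complex.I_re, Complex.I_im]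
    ring
  have him : ∀ u : ℂ, ((u - ε * Complex.I) / (u + ε * Complex.I)).im =
      (-2 * ε * u.re) / Complex.normSq (u + ε * Complex.I) := by
    intro u
    simp only [Complex.div_im, Complex.sub_re, Complex.add_re, Complex.sub_im, Complex.add_im,
      Complex.re_ofReal_mul, Complex.im_ofReal_mul, Complex.I_re, Complex.I_im]
    ring
  set h : ℂ → ℂ := fun w => (w - (x + (1 / 2 + ε * Complex.I) * d)) /
    (w - (x + (1 / 2 - ε * Complex.I) * d)) with hh
  have hexp : ∀ w ∈ K, Complex.exp (g₁ w - g₂ w) = h w := fun w hw => by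
    rw [Complex.exp_sub, he₁ w hw, he₂ w hw]
  have hsl : ∀ w ∈ K \ {x + 1 / 2 * d}, h w ∈ Complex.slitPlane := by
    rintro w ⟨hw, hwm⟩
    obtain ⟨u, rfl⟩ : ∃ u : ℂ, w = x + (u + 1 / 2) * d := ⟨(w - x) / d - 1 / 2, by field_simp; ring⟩
    by_contra hns
    rw [Complex.mem_slitPlane_iff, not_or, not_lt, not_not] at hns
    rw [hh] at hns
    dsimp only at hns
    rw [hquot, hre, him] at hns
    have hpos : 0 < Complex.normSq (u + ε * Complex.I) := by
      rw [Complex.normSq_pos]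
      intro h0
      have h2 := Complex.exp_ne_zero (g₂ (x + (u + 1 / 2) * d))
      rw [he₂ _ hw] at h2
      apply h2
      linear_combination d * h0
    have hu : u.re = 0 := by
      have := hns.2
      rw [div_eq_zero_iff] at this
      rcases this with h | h
      · rcases mul_eq_zero.1 h with h | h
        · linarith
        · exact h
      · exact absurd h hpos.ne'
    have hub : u.im ^ 2 ≤ ε ^ 2 := by
      have := hns.1
      by_contra hlt
      rw [not_le] at hlt
      have : 0 < (u.re ^ 2 + u.im ^ 2 - ε ^ 2) / Complex.normSq (u + ε * Complex.I) := by
        apply div_pos _ hpos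
        rw [hu]; nlinarith
      linarith
    have hu' : u = u.im * Complex.I := by
      apply Complex.ext <;> simp [hu]
    have := hmid u.im (abs_le.1 (abs_le_of_sq_le_sq hub hε.le)) (by
      rw [← hu', add_comm (1 / 2 : ℂ)]; exact hw)
    apply hwm
    rw [hu', this]
    simp
  -- The difference of the two logarithms of `h` is a constant multiple of `2πi`.
  obtain ⟨c, hc1, hc⟩ : ∃ c : ℂ, Complex.exp c = 1 ∧
      ∀ w ∈ K \ {x + 1 / 2 * d}, g₁ w - g₂ w - Complex.log (h w) = c := by
    have hcont : ContinuousOn (fun w => g₁ w - g₂ w - Complex.log (h w)) (K \ {x + 1 / 2 * d}) := by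
      refine ((hg₁.mono sdiff_subset).sub (hg₂.mono sdiff_subset)).sub (ContinuousOn.clog ?_ hsl)
      refine ContinuousOn.div (by fun_prop) (by fun_prop) fun w hw h0 => ?_
      exact Complex.slitPlane_ne_zero (hsl w hw) (by simp only [hh]; rw [h0, div_zero])
    have hone : ∀ w ∈ K \ {x + 1 / 2 * d},
        Complex.exp (g₁ w - g₂ w - Complex.log (h w)) = 1 := by
      intro w hw
      have h0 := Complex.slitPlane_ne_zero (hsl w hw)
      rw [Complex.exp_sub, hexp w hw.1, Complex.exp_log h0, div_self h0]
    have h0K : x + ((0 : ℝ) : ℂ) * d ∈ K \ {x + 1 / 2 * d} := by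
      refine ⟨hseg 0 (by simp), fun h => hd ?_⟩
      rw [mem_singleton_iff] at h
      push_cast at h
      linear_combination (-2) * h
    refine ⟨_, hone _ h0K, fun w hw => ?_⟩
    obtain ⟨n, hn⟩ := Complex.exp_eq_one_iff.1 (hone w hw)
    obtain ⟨n₀, hn₀⟩ := Complex.exp_eq_one_iff.1 (hone _ h0K)
    have hint : ((fun z : ℂ => z.im / (2 * Real.pi)) ''
        ((fun w => g₁ w - g₂ w - Complex.log (h w)) '' (K \ {x + 1 / 2 * d}))).OrdConnected :=
      ((hconn.image _ hcont).image _ (by fun_prop)).ordConnected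
    have hval : ∀ k : ℤ, (k * (2 * (Real.pi : ℂ) * Complex.I)).im / (2 * Real.pi) = k := by
      intro k
      have : (k * (2 * (Real.pi : ℂ) * Complex.I)).im = k * (2 * Real.pi) := by simp
      rw [this]
      field_simp
    have haux : ∀ k l : ℤ, k < l → (k : ℝ) ∈ ((fun z : ℂ => z.im / (2 * Real.pi)) ''
        ((fun w => g₁ w - g₂ w - Complex.log (h w)) '' (K \ {x + 1 / 2 * d}))) →
        (l : ℝ) ∉ ((fun z : ℂ => z.im / (2 * Real.pi)) ''
        ((fun w => g₁ w - g₂ w - Complex.log (h w)) '' (K \ {x + 1 / 2 * d}))) := by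
      intro k l hkl hk hl
      have hkl' : (k : ℝ) + 1 ≤ l := by exact_mod_cast hkl
      obtain ⟨_, ⟨w, hw, rfl⟩, hwv⟩ := hint.out hk hl
        (⟨by linarith, by linarith⟩ : (k : ℝ) + 1 / 2 ∈ Icc (k : ℝ) l)
      obtain ⟨j, hj⟩ := Complex.exp_eq_one_iff.1 (hone w hw)
      dsimp only at hwv
      rw [hj, hval] at hwv
      have h2 : ((2 * j : ℤ) : ℝ) = ((2 * k + 1 : ℤ) : ℝ) := by push_cast; linarith
      have h3 : 2 * j = 2 * k + 1 := by exact_mod_cast h2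
      omega
    have hnm : (n : ℝ) ∈ ((fun z : ℂ => z.im / (2 * Real.pi)) ''
        ((fun w => g₁ w - g₂ w - Complex.log (h w)) '' (K \ {x + 1 / 2 * d}))) :=
      ⟨_, ⟨w, hw, rfl⟩, by dsimp only; rw [hn, hval]⟩
    have hn₀m : (n₀ : ℝ) ∈ ((fun z : ℂ => z.im / (2 * Real.pi)) ''
        ((fun w => g₁ w - g₂ w - Complex.log (h w)) '' (K \ {x + 1 / 2 * d}))) :=
      ⟨_, ⟨_, h0K, rfl⟩, by dsimp only; rw [hn₀, hval]⟩
    have hnn : n = n₀ := by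
      rcases lt_trichotomy n n₀ with hlt | heq | hlt
      · exact absurd hn₀m (haux _ _ hlt hnm)
      · exact heq
      · exact absurd hnm (haux _ _ hlt hn₀m)
    rw [hn, hn₀, hnn]
  -- So `log ∘ h` extends continuously, as `G`, along the segment from `x` to `x + d`. Its imaginary
  -- part is nonnegative before the midpoint and nonpositive after it, although `h = -1` there.
  set G : ℝ → ℂ := fun s => g₁ (x + s * d) - g₂ (x + s * d) - c with hG
  have hGc : ContinuousOn G (Icc 0 1) := by
    refine ((hg₁.comp (by fun_prop) hseg).sub (hg₂.comp (by fun_prop) hseg)).sub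
      continuousOn_const
  have hGat : ContinuousAt (fun s => (G s).im) (1 / 2) :=
    Complex.continuous_im.continuousAt.comp
      (hGc.continuousAt (Icc_mem_nhds (by norm_num) (by norm_num)))
  have hGim : ∀ s ∈ Icc (0 : ℝ) 1, s ≠ 1 / 2 →
      (G s).im = Complex.arg (((s - 1 / 2 : ℝ) - ε * Complex.I) /
        ((s - 1 / 2 : ℝ) + ε * Complex.I)) := by
    intro s hs hne
    have hsK : x + s * d ∈ K \ {x + 1 / 2 * d} := by
      refine ⟨hseg s hs, fun h => hne ?_⟩
      have h1 : ((s : ℂ) - 1 / 2) * d = 0 := by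
        rw [mem_singleton_iff] at h
        linear_combination h
      rcases mul_eq_zero.1 h1 with h2 | h2
      · have h3 : (s : ℂ) = ((1 / 2 : ℝ) : ℂ) := by push_cast; linear_combination h2
        exact_mod_cast h3
      · exact absurd h2 hd
    have h1 : G s = Complex.log (h (x + s * d)) := by
      have := hc _ hsK
      simp only [hG]
      rw [← this]; ring
    have h2 := hquot ((s - 1 / 2 : ℝ) : ℂ)
    have h3 : (((s - 1 / 2 : ℝ) : ℂ) + 1 / 2) = s := by push_cast; ring
    rw [h3] at h2
    rw [h1, Complex.log_im, hh]
    dsimp only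
    rw [h2]
  have hle : (G (1 / 2)).im ≤ 0 := by
    refine le_of_tendsto (hGat.tendsto.mono_left (nhdsWithin_le_nhds (s := Ioi (1 / 2)))) ?_
    filter_upwards [Ioo_mem_nhdsGT (show (1 / 2 : ℝ) < 1 by norm_num)] with s hs
    rw [hGim s ⟨by linarith [hs.1], hs.2.le⟩ hs.1.ne']
    by_contra hlt
    have h1 : 0 ≤ ((((s - 1 / 2 : ℝ) : ℂ) - ε * Complex.I) /
      (((s - 1 / 2 : ℝ) : ℂ) + ε * Complex.I)).im := Complex.arg_nonneg_iff.1 (not_le.1 hlt).le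
    rw [him, Complex.ofReal_re] at h1
    have hpos : 0 < Complex.normSq (((s - 1 / 2 : ℝ) : ℂ) + ε * Complex.I) := by
      rw [Complex.normSq_pos]
      intro h0
      have := congrArg Complex.im h0
      simp at this
      exact hε.ne' this
    have h2 : -2 * ε * (s - 1 / 2) < 0 := by nlinarith [mul_pos hε (sub_pos.2 hs.1)]
    exact absurd h1 (not_le.2 (div_neg_of_neg_of_pos h2 hpos))
  have hge : 0 ≤ (G (1 / 2)).im := by
    refine ge_of_tendsto (hGat.tendsto.mono_left (nhdsWithin_le_nhds (s := Iio (1 / 2)))) ?_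
    filter_upwards [Ioo_mem_nhdsLT (show (0 : ℝ) < 1 / 2 by norm_num)] with s hs
    rw [hGim s ⟨hs.1.le, by linarith [hs.2]⟩ hs.2.ne, Complex.arg_nonneg_iff, him,
      Complex.ofReal_re]
    apply div_nonneg _ (Complex.normSq_nonneg _)
    nlinarith [mul_pos hε (sub_pos.2 hs.2)]
  have hm : Complex.exp (G (1 / 2)) = -1 := by
    simp only [hG]
    rw [Complex.exp_sub, hexp _ (hseg _ (by norm_num)), hc1, div_one]
    have h2 := hquot 0
    rw [zero_add, zero_sub, zero_add, neg_div, div_self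
      (mul_ne_zero (by exact_mod_cast hε.ne') Complex.I_ne_zero)] at h2
    simp only [hh]
    push_cast
    exact h2
  have hmre := congrArg Complex.re hm
  rw [Complex.exp_re, le_antisymm hle hge, Real.cos_zero, mul_one] at hmre
  have := Real.exp_pos (G (1 / 2)).re
  simp at hmre
  linarith

/-! ### Points visible across a curve -/

/-- Let `R` be a connected compact set in a plane region `P` without holes. If `p` and `q`
are the only points of `R` visible from `x` in `P`, then they lie on the same ray from `x`.
Otherwise `[x, p] ∪ R ∪ [x, q]` would enclose one side of `[x, p]`, and a ray from `x` into that
side would first hit this set at a further visible point of `R`. -/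
theorem sameRay_of_forall_visible_eq_complex {P R : Set ℂ} (hH : HoleFree P)
    (hR : IsCompact R) (hRc : IsPreconnected R) (hRP : R ⊆ P) {x p q : ℂ} (hp : p ∈ R) (hq : q ∈ R)
    (hxp : segment ℝ x p ⊆ P) (hxq : segment ℝ x q ⊆ P)
    (hvis : ∀ r ∈ R, segment ℝ x r ⊆ P → r = p ∨ r = q) :
    SameRay ℝ (p - x) (q - x) := by
  by_contra hray
  have hd : p - x ≠ 0 := fun h => hray (by rw [h]; exact SameRay.zero_left _)
  set d := p - x with hd'
  set ω := (q - x) / d with hω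
  have hqω : q = x + ω * d := by rw [hω]; field_simp; ring
  have hω0 : ∀ c : ℝ, 0 ≤ c → ω ≠ c := by
    intro c hc h
    apply hray
    have : q - x = c • d := by rw [hqω, h, Complex.real_smul]; ring
    rw [this]
    exact SameRay.sameRay_nonneg_smul_right _ hc
  have hpmem : ∀ w, w ∈ segment ℝ x p ↔ ∃ s ∈ Icc (0 : ℝ) 1, w = x + s * d := by
    intro w
    rw [segment_eq_image']
    simp only [mem_image, ← hd', Complex.real_smul, eq_comm]
  have hqmem : ∀ w, w ∈ segment ℝ x q ↔ ∃ t ∈ Icc (0 : ℝ) 1, w = x + (t * ω) * d := by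
    intro w
    rw [segment_eq_image']
    have : ∀ t : ℝ, x + t • (q - x) = x + (t * ω) * d := by
      intro t; rw [hqω, Complex.real_smul]; ring
    simp only [mem_image, this, eq_comm]
  have hcancel : ∀ a b : ℂ, x + a * d = x + b * d → a = b := fun a b h =>
    mul_right_cancel₀ hd (add_left_cancel h)
  -- `R` keeps a distance from the first half of `[x, p]`
  have hhalf : ∀ s ∈ Icc (0 : ℝ) (1 / 2), x + s * d ∉ R := by
    intro s hs hsR
    have hsub : segment ℝ x (x + s * d) ⊆ P :=
      ((convex_segment x p).segment_subset (left_mem_segment ℝ x p)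
        ((hpmem _).2 ⟨s, ⟨hs.1, by linarith [hs.2]⟩, rfl⟩)).trans hxp
    rcases hvis _ hsR hsub with h | h
    · have h1 : (s : ℂ) = ((1 : ℝ) : ℂ) := hcancel _ _ (by rw [h, hd']; push_cast; ring)
      have h2 : s = 1 := by exact_mod_cast h1
      linarith [hs.2]
    · exact hω0 s hs.1 (hcancel _ _ (by rw [h, ← hqω]))
  obtain ⟨δ, hδ, hδR⟩ : ∃ δ > 0, Metric.thickening δ
      ((fun s : ℝ => x + s * d) '' Icc (0 : ℝ) (1 / 2)) ⊆ Rᶜ := by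
    refine IsCompact.exists_thickening_subset_open
      (isCompact_Icc.image (by fun_prop)) hR.isClosed.isOpen_compl ?_
    rintro _ ⟨s, hs, rfl⟩
    exact hhalf s hs
  obtain ⟨e, he, hew⟩ : ∃ e > (0 : ℝ), ω.im ≠ 0 → 2 * e * |ω.re| < |ω.im| := by
    by_cases h : ω.im = 0
    · exact ⟨1, one_pos, fun h' => absurd h h'⟩
    · have h1 : 0 < |ω.im| := abs_pos.2 h
      refine ⟨|ω.im| / (2 * (|ω.re| + 1)), by positivity, fun _ => ?_⟩
      have h2 : 2 * (|ω.im| / (2 * (|ω.re| + 1))) * |ω.re| = |ω.im| * (|ω.re| / (|ω.re| + 1)) := by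
        field_simp
      rw [h2]
      have h3 : |ω.re| / (|ω.re| + 1) < 1 := by
        rw [div_lt_one (by positivity)]; linarith
      nlinarith
  obtain ⟨ε, hε, hεe, hεδ⟩ : ∃ ε > (0 : ℝ), ε ≤ e ∧ ε * ‖d‖ < δ := by
    have h0 : 0 < ‖d‖ := norm_pos_iff.2 hd
    refine ⟨min e (δ / (2 * ‖d‖)), lt_min he (by positivity), min_le_left _ _, ?_⟩
    calc min e (δ / (2 * ‖d‖)) * ‖d‖ ≤ δ / (2 * ‖d‖) * ‖d‖ := by
          gcongr; exact min_le_right _ _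
      _ = δ / 2 := by field_simp
      _ < δ := by linarith
  -- Within the sector of directions `1 ± 2εi` around `[x, p]` the rest of the curve is not met
  -- before the perpendicular through the midpoint.
  have hsecR : ∀ s τ : ℝ, 0 ≤ s → s ≤ 1 / 2 → |τ| ≤ ε → x + (s + τ * Complex.I) * d ∉ R := by
    intro s τ hs hs' hτ
    apply hδR
    rw [Metric.mem_thickening_iff]
    refine ⟨_, ⟨s, ⟨hs, hs'⟩, rfl⟩, ?_⟩
    have : x + (s + τ * Complex.I) * d - (x + s * d) = τ * Complex.I * d := by ring
    dsimp only
    rw [dist_eq_norm, this, norm_mul, norm_mul, Complex.norm_I, mul_one, Complex.norm_real,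
      Real.norm_eq_abs]
    exact (mul_le_mul_of_nonneg_right hτ (norm_nonneg _)).trans_lt hεδ
  have hsecq : ∀ s τ : ℝ, 0 < s → |τ| ≤ 2 * ε * s →
      x + (s + τ * Complex.I) * d ∉ segment ℝ x q := by
    intro s τ hs hτ h
    obtain ⟨t, ht, hteq⟩ := (hqmem _).1 h
    have h1 := hcancel _ _ hteq
    have hre : s = t * ω.re := by simpa using congrArg Complex.re h1
    have him : τ = t * ω.im := by simpa using congrArg Complex.im h1
    have ht0 : 0 < t := by
      rcases ht.1.eq_or_lt with h0 | h0
      · rw [← h0, zero_mul] at hre; exact absurd hre hs.ne'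
      · exact h0
    by_cases hi : ω.im = 0
    · refine hω0 ω.re ?_ (by apply Complex.ext <;> simp [hi])
      by_contra hlt
      nlinarith
    · have h2 := hew hi
      rw [him, hre, abs_mul, abs_of_pos ht0] at hτ
      have h3 : |ω.im| ≤ 2 * ε * ω.re := by
        by_contra hlt
        rw [not_le] at hlt
        nlinarith [mul_lt_mul_of_pos_left hlt ht0]
      have h4 : 2 * ε * ω.re ≤ 2 * e * |ω.re| := by
        have := le_abs_self ω.re
        have := abs_nonneg ω.re
        nlinarith [mul_le_mul_of_nonneg_left (le_abs_self ω.re) hε.le,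
          mul_le_mul_of_nonneg_right hεe (abs_nonneg ω.re)]
      linarith
  have hsecp : ∀ s τ : ℝ, x + (s + τ * Complex.I) * d ∈ segment ℝ x p → τ = 0 := by
    intro s τ h
    obtain ⟨t, ht, hteq⟩ := (hpmem _).1 h
    simpa using congrArg Complex.im (hcancel _ _ hteq)
  set K := segment ℝ x p ∪ (segment ℝ x q ∪ R) with hK
  have hsegc : ∀ y : ℂ, IsCompact (segment ℝ x y) := fun y => by
    rw [segment_eq_image']
    exact isCompact_Icc.image (by fun_prop)
  have hKc : IsCompact K := (hsegc p).union ((hsegc q).union hR)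
  have hKP : K ⊆ P := union_subset hxp (union_subset hxq hRP)
  -- If `K` enclosed the point just off the midpoint of `[x, p]`, on the side given by `σ`, then the
  -- ray from `x` through that point would lead to a further visible point of `R`.
  have hopen : ∀ σ : ℝ, σ = 1 ∨ σ = -1 → ∃ W : Set ℂ, IsPreconnected W ∧
      x + (1 / 2 + (σ * ε : ℝ) * Complex.I) * d ∈ W ∧ Disjoint W K ∧ ¬ Bornology.IsBounded W := by
    intro σ hσ
    have hσ0 : σ ≠ 0 := by rcases hσ with h | h <;> rw [h] <;> norm_num
    have hσa : |σ| = 1 := by rcases hσ with h | h <;> rw [h] <;> norm_num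
    by_contra! hcon
    have hform : ∀ t : ℝ, x + t • ((1 / 2 + (σ * ε : ℝ) * Complex.I) * d) =
        x + ((t / 2 : ℝ) + (t * (σ * ε) : ℝ) * Complex.I) * d := by
      intro t; rw [Complex.real_smul]; push_cast; ring
    have hv : (1 / 2 + ((σ * ε : ℝ) : ℂ) * Complex.I) * d ≠ 0 := by
      refine mul_ne_zero (fun h => ?_) hd
      have := congrArg Complex.re h
      simp at this
    have hpq : ∀ t : ℝ, 0 < t → x + t • ((1 / 2 + (σ * ε : ℝ) * Complex.I) * d) ∉ segment ℝ x p ∧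
        x + t • ((1 / 2 + (σ * ε : ℝ) * Complex.I) * d) ∉ segment ℝ x q := by
      intro t ht
      rw [hform]
      refine ⟨fun h => mul_ne_zero ht.ne' (mul_ne_zero hσ0 hε.ne') (hsecp _ _ h),
        hsecq _ _ (by linarith) ?_⟩
      rw [abs_mul, abs_mul, hσa, abs_of_pos ht, abs_of_pos hε]
      linarith
    obtain ⟨s, hs, hsK, hsP⟩ := hH.exists_mem_ray_segment_subset hKc.isClosed hKP
      (hxp (left_mem_segment ℝ x p)) hv (fun W hW hz hWK => hcon W hW hz hWK) (by
        rintro t ⟨ht0, ht1⟩ (h | h | h)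
        · exact (hpq t ht0).1 h
        · exact (hpq t ht0).2 h
        · rw [hform] at h
          refine hsecR _ _ (by linarith) (by linarith) ?_ h
          rw [abs_mul, abs_mul, hσa, abs_of_pos ht0, abs_of_pos hε]
          nlinarith)
    rcases hsK with h | h | h
    · exact (hpq s hs).1 h
    · exact (hpq s hs).2 h
    · rcases hvis _ h hsP with h1 | h1
      · exact (hpq s hs).1 (h1 ▸ right_mem_segment ℝ x p)
      · exact (hpq s hs).2 (h1 ▸ right_mem_segment ℝ x q)
  have hlog : ∀ σ : ℝ, σ = 1 ∨ σ = -1 → ∃ g : ℂ → ℂ, ContinuousOn g K ∧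
      ∀ w ∈ K, Complex.exp (g w) = w - (x + (1 / 2 + (σ * ε : ℝ) * Complex.I) * d) := by
    intro σ hσ
    obtain ⟨W, hW, hz, hWK, hWb⟩ := hopen σ hσ
    exact exists_continuousOn_log_sub hKc hW hWb hWK hz
  have hIcc : ∀ s ∈ Icc (0 : ℝ) 1, x + s * d ∈ segment ℝ x p := fun s hs => (hpmem _).2 ⟨s, hs, rfl⟩
  refine not_exists_log_sub_and_exists_log_sub hd hε (fun s hs => Or.inl (hIcc s hs)) ?_ ?_
    (by simpa using hlog 1 (Or.inl rfl)) (by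
      have := hlog (-1) (Or.inr rfl)
      simpa [sub_eq_add_neg] using this)
  · intro τ hτ h
    have hhalf' : (1 / 2 : ℂ) = ((1 / 2 : ℝ) : ℂ) := by push_cast; rfl
    rw [hhalf'] at h
    rcases h with h | h | h
    · exact hsecp _ _ h
    · refine absurd h (hsecq _ _ (by norm_num) ?_)
      have := abs_le.2 hτ
      linarith
    · exact absurd h (hsecR _ _ (by norm_num) le_rfl (abs_le.2 hτ))
  · -- Removing the midpoint leaves two halves of `[x, p]`, joined by `[x, q] ∪ R`.
    have hm : (x + 1 / 2 * d) = x + (((1 / 2 : ℝ) : ℂ) + (0 : ℝ) * Complex.I) * d := by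
      push_cast; ring
    have hmR : x + 1 / 2 * d ∉ R := by
      rw [hm]; exact hsecR _ _ (by norm_num) le_rfl (by simpa using hε.le)
    have hmq : x + 1 / 2 * d ∉ segment ℝ x q := by
      rw [hm]; exact hsecq _ _ (by norm_num) (by simp [hε.le])
    have hKm : K \ {x + 1 / 2 * d} = (((fun s : ℝ => x + s * d) '' Ico 0 (1 / 2)) ∪
        (segment ℝ x q ∪ R)) ∪ ((fun s : ℝ => x + s * d) '' Ioc (1 / 2) 1) := by
      have hne : ∀ s : ℝ, s ≠ 1 / 2 → x + s * d ≠ x + 1 / 2 * d := by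
        intro s hs h
        have h1 : (s : ℂ) = ((1 / 2 : ℝ) : ℂ) := by rw [hcancel _ _ h]; push_cast; rfl
        exact hs (by exact_mod_cast h1)
      ext w
      constructor
      · rintro ⟨hw | hw, hwm⟩
        · obtain ⟨s, hs, rfl⟩ := (hpmem _).1 hw
          rcases lt_trichotomy s (1 / 2) with h | h | h
          · exact Or.inl (Or.inl ⟨s, ⟨hs.1, h⟩, rfl⟩)
          · exact absurd (by rw [h]; push_cast; rfl) hwm
          · exact Or.inr ⟨s, ⟨h, hs.2⟩, rfl⟩
        · exact Or.inl (Or.inr hw)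
      · rintro ((⟨s, hs, rfl⟩ | hw) | ⟨s, hs, rfl⟩)
        · exact ⟨Or.inl (hIcc s ⟨hs.1, by linarith [hs.2]⟩), hne s hs.2.ne⟩
        · refine ⟨Or.inr hw, ?_⟩
          rintro rfl
          exact hw.elim hmq hmR
        · exact ⟨Or.inl (hIcc s ⟨by linarith [hs.1], hs.2⟩), hne s hs.1.ne'⟩
    rw [hKm]
    refine IsPreconnected.union p (Or.inr (Or.inr hp)) ⟨1, by norm_num, by simp [hd']⟩
      (IsPreconnected.union x ⟨0, by norm_num, by simp⟩ (Or.inl (left_mem_segment ℝ x q)) ?_ ?_) ?_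
    · exact isPreconnected_Ico.image _ (by fun_prop)
    · exact IsPreconnected.union q (right_mem_segment ℝ x q) hq
        (convex_segment x q).isPreconnected hRc
    · exact isPreconnected_Ioc.image _ (by fun_prop)

/-- The preceding fact, carried over to the Euclidean plane by an isometry with `ℂ`. -/
theorem sameRay_of_forall_visible_eq {P R : Set Plane} (hH : HoleFree P)
    (hR : IsCompact R) (hRc : IsPreconnected R) (hRP : R ⊆ P) {x p q : Plane} (hp : p ∈ R)
    (hq : q ∈ R) (hxp : p ∈ visibilityRegion P x) (hxq : q ∈ visibilityRegion P x)
    (hvis : ∀ r ∈ R, r ∈ visibilityRegion P x → r = p ∨ r = q) :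
    SameRay ℝ (p - x) (q - x) := by
  let φ : Plane ≃ₗᵢ[ℝ] ℂ := Complex.orthonormalBasisOneI.repr.symm
  have hseg : ∀ a b : Plane, segment ℝ (φ a) (φ b) = φ '' segment ℝ a b := fun a b =>
    (image_segment ℝ φ.toLinearEquiv.toLinearMap.toAffineMap a b).symm
  have hsub : ∀ a b : Plane, segment ℝ (φ a) (φ b) ⊆ φ '' P ↔ segment ℝ a b ⊆ P := fun a b => by
    rw [hseg, image_subset_image_iff φ.injective]
  have h := sameRay_of_forall_visible_eq_complex (P := φ '' P) (R := φ '' R) (x := φ x) (p := φ p)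
    (q := φ q) ?_ (hR.image φ.continuous)
    (hRc.image _ φ.continuous.continuousOn) (image_mono hRP) (mem_image_of_mem _ hp)
    (mem_image_of_mem _ hq) ((hsub _ _).2 hxp) ((hsub _ _).2 hxq) ?_
  · rw [← map_sub, ← map_sub] at h
    exact (SameRay.sameRay_map_iff φ.toLinearEquiv).1 h
  · intro z hz
    obtain ⟨y, rfl⟩ := φ.surjective z
    obtain ⟨W, hWc, hyW, hWb, hWP⟩ := hH y fun hy => hz (mem_image_of_mem _ hy)
    refine ⟨φ '' W, hWc.image _ φ.continuous.continuousOn, mem_image_of_mem _ hyW, fun hb => hWb ?_,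
      (disjoint_image_iff φ.injective).2 hWP⟩
    rw [isBounded_iff_forall_norm_le] at hb ⊢
    obtain ⟨C, hC⟩ := hb
    exact ⟨C, fun w hw => by simpa using hC _ (mem_image_of_mem φ hw)⟩
  · rintro _ ⟨r, hr, rfl⟩ hvr
    rcases hvis r hr ((hsub _ _).1 hvr) with h | h
    · exact Or.inl (by rw [h])
    · exact Or.inr (by rw [h])

/-! ### The region of a polygon -/

theorem isClosed_polygon_boundary {n : ℕ} (Q : Polygon Plane n) : IsClosed (Q.boundary ℝ) := by
  refine isClosed_iUnion_of_finite fun i => ?_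
  rw [Polygon.edgeSet_eq_image_edgePath]
  exact (isCompact_Icc.image (AffineMap.continuous_of_finiteDimensional _)).isClosed

theorem disjoint_connectedComponentIn_polygonRegion {n : ℕ} (Q : Polygon Plane n) {z : Plane}
    (hz : z ∉ polygonRegion Q) :
    Disjoint (connectedComponentIn (Q.boundary ℝ)ᶜ z) (polygonRegion Q) := by
  rw [disjoint_left]
  rintro w hw (h | ⟨_, h⟩)
  · exact connectedComponentIn_subset _ _ hw h
  · rw [← connectedComponentIn_eq hw] at h
    exact hz (Or.inr ⟨fun hzb => hz (Or.inl hzb), h⟩)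

theorem holeFree_polygonRegion {n : ℕ} (Q : Polygon Plane n) : HoleFree (polygonRegion Q) :=
  fun z hz => ⟨connectedComponentIn (Q.boundary ℝ)ᶜ z, isPreconnected_connectedComponentIn,
    mem_connectedComponentIn fun h => hz (Or.inl h),
    fun h => hz (Or.inr ⟨fun hzb => hz (Or.inl hzb), h⟩),
    disjoint_connectedComponentIn_polygonRegion Q hz⟩

theorem isClosed_polygonRegion {n : ℕ} (Q : Polygon Plane n) : IsClosed (polygonRegion Q) := by
  rw [← isOpen_compl_iff, isOpen_iff_forall_mem_open]
  exact fun z hz => ⟨connectedComponentIn (Q.boundary ℝ)ᶜ z,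
    (disjoint_connectedComponentIn_polygonRegion Q hz).subset_compl_right,
    (isClosed_polygon_boundary Q).isOpen_compl.connectedComponentIn,
    mem_connectedComponentIn fun h => hz (Or.inl h)⟩

/-! ### Lengths and shortest paths -/

theorem eVariationOn_Icc_add_Icc {α E : Type*} [LinearOrder α] [PseudoEMetricSpace E] (f : α → E)
    {a b c : α} (hab : a ≤ b) (hbc : b ≤ c) :
    eVariationOn f (Icc a b) + eVariationOn f (Icc b c) = eVariationOn f (Icc a c) := by
  simpa using eVariationOn.Icc_add_Icc f (s := univ) hab hbc (mem_univ b)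

theorem eVariationOn_univ_eq_add_add {E : Type*} [PseudoEMetricSpace E] (f : unitInterval → E)
    {a b : unitInterval} (hab : a ≤ b) :
    eVariationOn f univ =
      eVariationOn f (Icc 0 a) + eVariationOn f (Icc a b) + eVariationOn f (Icc b 1) := by
  rw [eVariationOn_Icc_add_Icc f unitInterval.nonneg' hab,
    eVariationOn_Icc_add_Icc f unitInterval.nonneg' unitInterval.le_one']
  congr
  exact Icc_bot_top.symm

theorem eVariationOn_lineMap_le (p q : Plane) {u : unitInterval → ℝ} {a b : unitInterval}
    (hab : a ≤ b) (hu : MonotoneOn u (Icc a b)) (ha : 0 ≤ u a) (hb : u b ≤ 1) :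
    eVariationOn (fun t => AffineMap.lineMap p q (u t)) (Icc a b) ≤ edist p q := by
  have hlip : LipschitzWith (nndist p q) (AffineMap.lineMap p q : ℝ → Plane) :=
    lipschitzWith_lineMap p q
  have h1 := (hlip.lipschitzOnWith (s := univ)).comp_eVariationOn_le (mapsTo_univ u (Icc a b))
  have h2 := (hu.eVariationOn_eq (left_mem_Icc.2 hab) (right_mem_Icc.2 hab)).le
  rw [inter_self] at h2
  have h3 : ENNReal.ofReal (u b - u a) ≤ 1 := by
    rw [← ENNReal.ofReal_one]
    exact ENNReal.ofReal_le_ofReal (by linarith)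
  calc _ ≤ (nndist p q : ENNReal) * eVariationOn u (Icc a b) := h1
    _ ≤ nndist p q * 1 := by gcongr; exact h2.trans h3
    _ = edist p q := by rw [mul_one, edist_nndist]

theorem pathLength_trans {a b c : Plane} (γ : Path a b) (σ : Path b c) :
    pathLength (γ.trans σ) = pathLength γ + pathLength σ := by
  let m : unitInterval := ⟨1 / 2, by norm_num, by norm_num⟩
  let φ : unitInterval → unitInterval := fun t => projIcc 0 1 zero_le_one (2 * t)
  let ψ : unitInterval → unitInterval := fun t => projIcc 0 1 zero_le_one (2 * t - 1)
  have hφ : Monotone φ := fun s t h => monotone_projIcc _ (by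
    have : (s : ℝ) ≤ t := h
    linarith)
  have hψ : Monotone ψ := fun s t h => monotone_projIcc _ (by
    have : (s : ℝ) ≤ t := h
    linarith)
  have h1 : eVariationOn (γ.trans σ) (Icc 0 m) = pathLength γ := by
    have heq : EqOn (γ.trans σ) (γ ∘ φ) (Icc 0 m) := by
      intro t ht
      have ht' : (t : ℝ) ≤ 1 / 2 := ht.2
      rw [Path.trans_apply, dif_pos ht', Function.comp_apply]
      congr 1
      exact (projIcc_of_mem zero_le_one _).symm
    rw [eVariationOn.congr heq, eVariationOn.comp_eq_of_monotoneOn _ _ (hφ.monotoneOn _)]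
    congr 1
    refine eq_univ_of_forall fun t => ⟨⟨t / 2, by linarith [t.2.1], by linarith [t.2.2]⟩,
      ⟨bot_le, ?_⟩, ?_⟩
    · change (t : ℝ) / 2 ≤ 1 / 2
      linarith [t.2.2]
    · change projIcc 0 1 zero_le_one (2 * ((t : ℝ) / 2)) = t
      rw [mul_div_cancel₀ _ two_ne_zero, projIcc_val]
  have h2 : eVariationOn (γ.trans σ) (Icc m 1) = pathLength σ := by
    have heq : EqOn (γ.trans σ) (σ ∘ ψ) (Icc m 1) := by
      intro t ht
      have ht' : (1 / 2 : ℝ) ≤ t := ht.1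
      rw [Path.trans_apply, Function.comp_apply]
      split_ifs with h
      · have h3 : (t : ℝ) = 1 / 2 := le_antisymm h ht'
        have h4 : ψ t = 0 := by
          change projIcc 0 1 zero_le_one (2 * (t : ℝ) - 1) = 0
          rw [h3]; norm_num
        have h5 : (⟨2 * t, (unitInterval.mul_pos_mem_iff zero_lt_two).2 ⟨t.2.1, h⟩⟩ :
            unitInterval) = 1 := by
          apply Subtype.ext
          change 2 * (t : ℝ) = 1
          rw [h3]; norm_num
        rw [h4, h5, γ.target, σ.source]
      · congr 1
        exact (projIcc_of_mem zero_le_one _).symm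
    rw [eVariationOn.congr heq, eVariationOn.comp_eq_of_monotoneOn _ _ (hψ.monotoneOn _)]
    congr 1
    refine eq_univ_of_forall fun t => ⟨⟨(t + 1) / 2, by linarith [t.2.1], by linarith [t.2.2]⟩,
      ⟨?_, le_top⟩, ?_⟩
    · change (1 / 2 : ℝ) ≤ ((t : ℝ) + 1) / 2
      linarith [t.2.1]
    · change projIcc 0 1 zero_le_one (2 * (((t : ℝ) + 1) / 2) - 1) = t
      rw [mul_div_cancel₀ _ two_ne_zero, add_sub_cancel_right, projIcc_val]
  rw [← h1, ← h2, eVariationOn_Icc_add_Icc _ (unitInterval.nonneg' (t := m)) unitInterval.le_one']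
  unfold pathLength
  congr 1
  exact Icc_bot_top.symm

theorem pathLength_symm {a b : Plane} (γ : Path a b) : pathLength γ.symm = pathLength γ := by
  have h := eVariationOn.comp_eq_of_antitoneOn γ (t := univ) unitInterval.symm
    (unitInterval.strictAnti_symm.antitone.antitoneOn _)
  rw [image_univ_of_surjective unitInterval.symm_bijective.surjective] at h
  exact h

theorem isShortestPath_segment {E : Set Plane} {s t : Plane} (h : segment ℝ s t ⊆ E) :
    IsShortestPath E (Path.segment s t) := by
  have hle : pathLength (Path.segment s t) ≤ edist s t := by
    have := eVariationOn_lineMap_le s t (u := fun r => (r : ℝ)) (a := 0) (b := 1) bot_le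
      (fun _ _ _ _ h => h) (by simp) (by simp)
    refine le_trans (le_of_eq ?_) this
    unfold pathLength
    rw [show (univ : Set unitInterval) = Icc 0 1 from Icc_bot_top.symm]
    rfl
  refine ⟨by rwa [Path.range_segment], (hle.trans_lt (edist_lt_top _ _)).ne,
    fun σ _ => hle.trans ?_⟩
  simpa [pathLength] using eVariationOn.edist_le σ (mem_univ 0) (mem_univ 1)

/-- A collapsed watchman route is a shortest path between its endpoints: following the route forth
and any other path back gives a watchman route through the same endpoints. -/
theorem IsCollapsedWatchmanRoute.isShortestPath {E : Set Plane} {a b : Plane} {γ : Path a b}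
    (h : IsCollapsedWatchmanRoute E γ) : IsShortestPath E γ := by
  have hrange : ∀ σ : Path a b, range (γ.trans σ.symm) = range γ ∪ range σ := fun σ => by
    rw [Path.trans_range, Path.symm_range]
  have hγ : range (γ.trans γ.symm) = range γ := by rw [hrange, union_self]
  have hsub : range γ ⊆ E := hγ ▸ h.isWatchmanRoute.subset
  refine ⟨hsub, h.rectifiable, fun σ hσ => ?_⟩
  have hw : IsWatchmanRoute E (γ.trans σ.symm) := by
    refine ⟨by rw [hrange]; exact union_subset hsub hσ, fun x hx => ?_⟩
    obtain ⟨y, hy, hxy⟩ := h.isWatchmanRoute.sees x hx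
    rw [hγ] at hy
    exact ⟨y, by rw [hrange]; exact Or.inl hy, hxy⟩
  have hmin := h.minimal a _ hw (by rw [hrange]; exact Or.inl ⟨0, γ.source⟩)
    (by rw [hrange]; exact Or.inl ⟨1, γ.target⟩)
  rw [pathLength_trans, pathLength_trans, pathLength_symm, pathLength_symm] at hmin
  exact (ENNReal.add_le_add_iff_left h.rectifiable).1 hmin

/-- If the chord between two points of a shortest path stays in the environment, the path runs
along that chord between them. -/
theorem IsShortestPath.mem_segment {E : Set Plane} {s t : Plane} {γ : Path s t}
    (h : IsShortestPath E γ) {a b c : unitInterval} (hac : a ≤ c) (hcb : c ≤ b)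
    (hseg : segment ℝ (γ a) (γ b) ⊆ E) : γ c ∈ segment ℝ (γ a) (γ b) := by
  have hab := hac.trans hcb
  rcases hab.eq_or_lt with heq | hlt
  · obtain rfl : c = a := le_antisymm (heq ▸ hcb) hac
    exact left_mem_segment ℝ _ _
  have hlt' : (0 : ℝ) < b - a := sub_pos.2 hlt
  -- Replace the part of `γ` over `[a, b]` by the chord.
  let u : unitInterval → ℝ := fun r => ((r : ℝ) - a) / (b - a)
  have hu0 : ∀ r, a ≤ r → 0 ≤ u r := fun r hr => div_nonneg (sub_nonneg.2 hr) hlt'.le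
  have hu1 : ∀ r, r ≤ b → u r ≤ 1 := fun r hr =>
    (div_le_one hlt').2 (sub_le_sub_right (show (r : ℝ) ≤ b from hr) _)
  have hua : u a = 0 := by simp [u]
  have hub : u b = 1 := div_self hlt'.ne'
  let f : unitInterval → Plane := fun r =>
    if r ≤ a then γ r else if r ≤ b then AffineMap.lineMap (γ a) (γ b) (u r) else γ r
  have hf1 : ∀ r, r ≤ a → f r = γ r := fun r hr => if_pos hr
  have hf2 : ∀ r ∈ Icc a b, f r = AffineMap.lineMap (γ a) (γ b) (u r) := by
    intro r hr
    rcases hr.1.eq_or_lt with heq | hlt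
    · rw [hf1 r heq.ge, ← heq, hua, AffineMap.lineMap_apply_zero]
    · simp only [f]; rw [if_neg (not_le.2 hlt), if_pos hr.2]
  have hf3 : ∀ r, b ≤ r → f r = γ r := by
    intro r hr
    rcases hr.eq_or_lt with heq | hlt
    · rw [hf2 r ⟨heq ▸ hab, heq.ge⟩, ← heq, hub, AffineMap.lineMap_apply_one]
    · simp only [f]; rw [if_neg (not_le.2 (hab.trans_lt hlt)), if_neg (not_le.2 hlt)]
  have hfc : Continuous f := by
    refine Continuous.if_le γ.continuous (Continuous.if_le ?_ γ.continuous continuous_id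
      continuous_const ?_) continuous_id continuous_const ?_
    · exact AffineMap.lineMap_continuous.comp (by fun_prop)
    · rintro r rfl; rw [hub, AffineMap.lineMap_apply_one]
    · rintro r rfl; rw [if_pos hab, hua, AffineMap.lineMap_apply_zero]
  let σ : Path s t :=
    { toFun := f
      continuous_toFun := hfc
      source' := by rw [hf1 0 bot_le, γ.source]
      target' := by rw [hf3 1 le_top, γ.target] }
  have hσ : range σ ⊆ E := by
    rintro _ ⟨r, rfl⟩
    change f r ∈ E
    rcases le_total r a with hr | hr
    · rw [hf1 r hr]; exact h.subset ⟨r, rfl⟩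
    rcases le_total r b with hr' | hr'
    · rw [hf2 r ⟨hr, hr'⟩]
      apply hseg
      rw [segment_eq_image_lineMap]
      exact ⟨u r, ⟨hu0 r hr, hu1 r hr'⟩, rfl⟩
    · rw [hf3 r hr']; exact h.subset ⟨r, rfl⟩
  have hmin := h.minimal σ hσ
  have hfin := h.rectifiable
  have hσl : pathLength σ ≤ eVariationOn γ (Icc 0 a) + edist (γ a) (γ b) +
      eVariationOn γ (Icc b 1) := by
    change eVariationOn f univ ≤ _
    rw [eVariationOn_univ_eq_add_add f hab,
      eVariationOn.congr (fun r (hr : r ∈ Icc 0 a) => hf1 r hr.2), eVariationOn.congr hf2,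
      eVariationOn.congr (fun r (hr : r ∈ Icc b 1) => hf3 r hr.1)]
    gcongr
    refine eVariationOn_lineMap_le _ _ hab (fun r _ r' _ hrr => ?_) hua.ge hub.le
    exact div_le_div_of_nonneg_right (sub_le_sub_right (show (r : ℝ) ≤ r' from hrr) _) hlt'.le
  have hγl : pathLength γ = eVariationOn γ (Icc 0 a) + eVariationOn γ (Icc a b) +
      eVariationOn γ (Icc b 1) := eVariationOn_univ_eq_add_add γ hab
  have hle : eVariationOn γ (Icc a b) ≤ edist (γ a) (γ b) := by
    rw [hγl] at hmin hfin
    have h1 := ENNReal.add_ne_top.1 hfin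
    have h2 := ENNReal.add_ne_top.1 h1.1
    have h3 := hmin.trans hσl
    exact (ENNReal.add_le_add_iff_left h2.1).1 ((ENNReal.add_le_add_iff_right h1.2).1 h3)
  have hsum : edist (γ a) (γ c) + edist (γ c) (γ b) ≤ edist (γ a) (γ b) := by
    refine le_trans (add_le_add (eVariationOn.edist_le γ (left_mem_Icc.2 hac)
      (right_mem_Icc.2 hac)) (eVariationOn.edist_le γ (left_mem_Icc.2 hcb)
      (right_mem_Icc.2 hcb))) ?_
    rwa [eVariationOn_Icc_add_Icc γ hac hcb]
  rw [edist_dist, edist_dist, edist_dist, ← ENNReal.ofReal_add dist_nonneg dist_nonneg,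
    ENNReal.ofReal_le_ofReal_iff dist_nonneg] at hsum
  rw [← affineSegment_eq_segment]
  exact dist_add_dist_eq_iff.1 (le_antisymm hsum (dist_triangle _ _ _))

/-! ### Visibility along shortest paths -/

theorem isClosed_visibilityRegion {E : Set Plane} (hE : IsClosed E) (x : Plane) :
    IsClosed (visibilityRegion E x) := by
  have : visibilityRegion E x = ⋂ t ∈ Icc (0 : ℝ) 1, (fun y => x + t • (y - x)) ⁻¹' E := by
    ext y
    simp only [visibilityRegion, segment_eq_image', image_subset_iff, mem_ofPred_eq, mem_iInter]
    rfl
  rw [this]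
  exact isClosed_biInter fun t _ => hE.preimage (by fun_prop)

theorem segment_subset_visibilityRegion {E : Set Plane} {x p q : Plane}
    (hp : p ∈ visibilityRegion E x) (hq : q ∈ visibilityRegion E x)
    (hray : SameRay ℝ (p - x) (q - x)) : segment ℝ p q ⊆ visibilityRegion E x := by
  -- One of `p`, `q` lies between `x` and the other.
  have key : ∀ {p q : Plane}, q ∈ visibilityRegion E x → p ∈ segment ℝ x q →
      segment ℝ p q ⊆ visibilityRegion E x := by
    intro p q hq hpq y hy
    have hy' : y ∈ segment ℝ x q :=
      (convex_segment x q).segment_subset hpq (right_mem_segment ℝ x q) hy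
    exact ((convex_segment x q).segment_subset (left_mem_segment ℝ x q) hy').trans hq
  have mem : ∀ {p q : Plane}, SameRay ℝ (p - x) (q - x) → ‖p - x‖ ≤ ‖q - x‖ →
      p ∈ segment ℝ x q := by
    intro p q hray hle
    rcases eq_or_ne (q - x) 0 with h0 | h0
    · rw [h0, norm_zero, norm_le_zero_iff, sub_eq_zero] at hle
      rw [hle]; exact left_mem_segment ℝ x q
    obtain ⟨r, hr, hr'⟩ := hray.exists_nonneg_right h0
    have hn : 0 < ‖q - x‖ := norm_pos_iff.2 h0
    rw [hr', norm_smul, Real.norm_of_nonneg hr] at hle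
    rw [segment_eq_image']
    refine ⟨r, ⟨hr, by by_contra hlt; nlinarith⟩, ?_⟩
    dsimp only
    rw [← hr', add_sub_cancel]
  rcases le_total ‖p - x‖ ‖q - x‖ with h | h
  · exact key hq (mem hray h)
  · rw [segment_symm]; exact key hp (mem hray.symm h)

/-- The excursions of a shortest path out of the region visible from `x` start and end on one ray
from `x`, so the path could be shortened along that ray; hence there are none. -/
theorem IsShortestPath.chainVisible {E : Set Plane} (hE : IsClosed E) (hH : HoleFree E)
    {s t : Plane} {γ : Path s t} (h : IsShortestPath E γ) (X : Set Plane) :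
    ChainVisible E X γ := by
  intro x _
  set V := visibilityRegion E x with hV
  have hA : IsClosed (γ ⁻¹' V) := (isClosed_visibilityRegion hE x).preimage γ.continuous
  rcases (γ ⁻¹' V).eq_empty_or_nonempty with hemp | hne
  · left
    rw [eq_empty_iff_forall_notMem]
    rintro _ ⟨hy, r, rfl⟩
    exact (hemp ▸ (show r ∈ γ ⁻¹' V from hy) : r ∈ (∅ : Set unitInterval))
  right
  have hAc : IsCompact (γ ⁻¹' V) := hA.isCompact
  obtain ⟨t₀, ht₀⟩ := hAc.exists_isLeast hne
  obtain ⟨t₁, ht₁⟩ := hAc.exists_isGreatest hne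
  refine ⟨t₀, t₁, ht₀.2 ht₁.1, subset_antisymm ?_ ?_⟩
  · rintro _ ⟨hy, r, rfl⟩
    exact ⟨r, ⟨ht₀.2 hy, ht₁.2 hy⟩, rfl⟩
  rintro _ ⟨c, hc, rfl⟩
  refine ⟨?_, c, rfl⟩
  by_contra hcV
  -- `a` and `b` are the times at which the excursion around time `c` starts and ends.
  obtain ⟨a, ha⟩ := (hAc.inter_right (isClosed_Iic (a := c))).exists_isGreatest ⟨t₀, ht₀.1, hc.1⟩
  obtain ⟨b, hb⟩ := (hAc.inter_right (isClosed_Ici (a := c))).exists_isLeast ⟨t₁, ht₁.1, hc.2⟩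
  have hac : a ≤ c := ha.1.2
  have hcb : c ≤ b := hb.1.2
  have hray : SameRay ℝ (γ a - x) (γ b - x) := by
    refine sameRay_of_forall_visible_eq (R := γ '' Icc a b) hH
      (isCompact_Icc.image γ.continuous) (isPreconnected_Icc.image _ γ.continuous.continuousOn)
      ((image_subset_range _ _).trans h.subset) ⟨a, left_mem_Icc.2 (hac.trans hcb), rfl⟩
      ⟨b, right_mem_Icc.2 (hac.trans hcb), rfl⟩ ha.1.1 hb.1.1 ?_
    rintro _ ⟨r, hr, rfl⟩ hrV
    rcases le_total r c with hrc | hrc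
    · left; rw [le_antisymm (ha.2 ⟨hrV, hrc⟩) hr.1]
    · right; rw [le_antisymm hr.2 (hb.2 ⟨hrV, hrc⟩)]
  have hsub := segment_subset_visibilityRegion ha.1.1 hb.1.1 hray
  refine hcV (hsub (h.mem_segment hac hcb fun y hy => hsub hy (right_mem_segment ℝ x y)))

/-! ### Terrains -/

theorem mem_terrainEnvironment_of_le {I : Set ℝ} {f : ℝ → ℝ} {w z : Plane}
    (hw : w ∈ terrainEnvironment I f) (h0 : w 0 = z 0) (h1 : w 1 ≤ z 1) :
    z ∈ terrainEnvironment I f :=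
  ⟨h0 ▸ hw.1, h0 ▸ hw.2.trans h1⟩

/-- A triangle whose boundary lies above the terrain lies above the terrain, since each of its
points is on or above the boundary: if `x` sees both ends of a horizontal segment in the
environment, then it sees all of the segment. -/
theorem mem_visibilityRegion_terrainEnvironment {I : Set ℝ} {f : ℝ → ℝ} {x p q y : Plane}
    (hp : p ∈ visibilityRegion (terrainEnvironment I f) x)
    (hq : q ∈ visibilityRegion (terrainEnvironment I f) x)
    (hpq : ∀ w : Plane, w 0 ∈ Icc (p 0) (q 0) → w 1 = y 1 → w ∈ terrainEnvironment I f)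
    (hy : y 0 ∈ Icc (p 0) (q 0)) (hp1 : p 1 = y 1) (hq1 : q 1 = y 1) :
    y ∈ visibilityRegion (terrainEnvironment I f) x := by
  change segment ℝ x y ⊆ _
  rw [segment_eq_image']
  rintro _ ⟨t, ht, rfl⟩
  have hseg : ∀ r ∈ visibilityRegion (terrainEnvironment I f) x, ∀ t' ∈ Icc (0 : ℝ) 1,
      x + t' • (r - x) ∈ terrainEnvironment I f := by
    intro r hr t' ht'
    apply hr
    rw [segment_eq_image']
    exact ⟨t', ht', rfl⟩
  -- The point of the segment `[x, r]` at parameter `t'` is on the vertical line through the given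
  -- point, and not above it.
  have hbelow : ∀ r ∈ visibilityRegion (terrainEnvironment I f) x, r 1 = y 1 →
      ∀ t' ∈ Icc (0 : ℝ) 1, t' * (r 0 - x 0) = t * (y 0 - x 0) →
      t' * (y 1 - x 1) ≤ t * (y 1 - x 1) → x + t • (y - x) ∈ terrainEnvironment I f := by
    intro r hr hr1 t' ht' h0 h1
    refine mem_terrainEnvironment_of_le (hseg r hr t' ht') ?_ ?_
    · simpa using h0
    · simpa [hr1] using h1
  have hx : x ∈ terrainEnvironment I f := hp (left_mem_segment ℝ x p)
  obtain ⟨ht0, ht1⟩ := ht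
  obtain ⟨hpy, hyq⟩ := hy
  rcases le_total (x 1) (y 1) with hxy | hxy
  · have hup : ∀ r ∈ visibilityRegion (terrainEnvironment I f) x, r 1 = y 1 →
        |y 0 - x 0| ≤ |r 0 - x 0| → 0 ≤ (y 0 - x 0) * (r 0 - x 0) →
        x + t • (y - x) ∈ terrainEnvironment I f := by
      intro r hr hr1 habs hsgn
      rcases eq_or_ne (r 0 - x 0) 0 with h0 | h0
      · have h2 : y 0 - x 0 = 0 := by
          rw [h0, abs_zero] at habs
          exact abs_nonpos_iff.1 habs
        refine hbelow r hr hr1 0 (by simp) (by rw [h2]; ring) ?_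
        nlinarith
      · have hc0 : 0 ≤ (y 0 - x 0) / (r 0 - x 0) := by
          have h2 : (y 0 - x 0) / (r 0 - x 0) = (y 0 - x 0) * (r 0 - x 0) / (r 0 - x 0) ^ 2 := by
            field_simp
          rw [h2]; positivity
        have hc1 : (y 0 - x 0) / (r 0 - x 0) ≤ 1 := by
          refine (le_abs_self _).trans ?_
          rw [abs_div, div_le_one (abs_pos.2 h0)]
          exact habs
        have hle : t * ((y 0 - x 0) / (r 0 - x 0)) ≤ t := mul_le_of_le_one_right ht0 hc1
        refine hbelow r hr hr1 (t * ((y 0 - x 0) / (r 0 - x 0)))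
          ⟨by positivity, hle.trans ht1⟩ (by field_simp) ?_
        exact mul_le_mul_of_nonneg_right hle (sub_nonneg.2 hxy)
    rcases le_total (x 0) (y 0) with hx0 | hx0
    · refine hup q hq hq1 ?_ (mul_nonneg (by linarith) (by linarith))
      rw [abs_of_nonneg (by linarith), abs_of_nonneg (by linarith)]
      linarith
    · refine hup p hp hp1 ?_ (mul_nonneg_of_nonpos_of_nonpos (by linarith) (by linarith))
      rw [abs_of_nonpos (by linarith), abs_of_nonpos (by linarith)]
      linarith
  · have hz0 : (x + t • (y - x)) 0 = x 0 + t * (y 0 - x 0) := by simp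
    have hz1 : (x + t • (y - x)) 1 = x 1 + t * (y 1 - x 1) := by simp
    rcases lt_or_ge (x 0 + t * (y 0 - x 0)) (p 0) with hzp | hzp
    · have hxp : x 0 < p 0 := by nlinarith
      have h0 : 0 < p 0 - x 0 := sub_pos.2 hxp
      refine hbelow p hp hp1 (t * (y 0 - x 0) / (p 0 - x 0))
        ⟨div_nonneg (mul_nonneg ht0 (by linarith)) h0.le, (div_le_one h0).2 (by linarith)⟩
        (by field_simp) ?_
      refine mul_le_mul_of_nonpos_right ?_ (sub_nonpos.2 hxy)
      rw [le_div_iff₀ h0]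
      exact mul_le_mul_of_nonneg_left (by linarith) ht0
    rcases lt_or_ge (q 0) (x 0 + t * (y 0 - x 0)) with hzq | hzq
    · have hxq : q 0 < x 0 := by nlinarith
      have h0 : 0 < x 0 - q 0 := sub_pos.2 hxq
      have hne : x 0 - q 0 ≠ 0 := h0.ne'
      refine hbelow q hq hq1 (t * (x 0 - y 0) / (x 0 - q 0))
        ⟨div_nonneg (mul_nonneg ht0 (by linarith)) h0.le, (div_le_one h0).2 (by linarith)⟩
        (by rw [div_mul_eq_mul_div, div_eq_iff hne]; ring) ?_
      refine mul_le_mul_of_nonpos_right ?_ (sub_nonpos.2 hxy)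
      rw [le_div_iff₀ h0]
      exact mul_le_mul_of_nonneg_left (by linarith) ht0
    · refine mem_terrainEnvironment_of_le (w := !₂[x 0 + t * (y 0 - x 0), y 1])
        (hpq _ (by simpa using ⟨hzp, hzq⟩) (by simp)) (by simp) ?_
      rw [hz1]
      simp only [Matrix.cons_val_one, Matrix.cons_val_fin_one]
      nlinarith

/-- Between a point where it takes the value `g a` and a point where it takes the value `g b`, a
continuous function has a stretch on which it takes exactly the values between these two. -/
theorem exists_image_Icc_eq_Icc {g : unitInterval → ℝ} (hg : Continuous g) (a b : unitInterval)
    (hab : g a ≤ g b) : ∃ t₀ t₁, t₀ ≤ t₁ ∧ g '' Icc t₀ t₁ = Icc (g a) (g b) := by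
  have key : ∀ {g : unitInterval → ℝ}, Continuous g → ∀ {a b : unitInterval}, a ≤ b → g a ≤ g b →
      ∃ t₀ t₁, t₀ ≤ t₁ ∧ g '' Icc t₀ t₁ = Icc (g a) (g b) := by
    intro g hg a b hab hgab
    obtain ⟨t₀, ⟨⟨ht₀a, ht₀b⟩, ht₀⟩, hmax⟩ := (isCompact_Icc.inter_right
      (isClosed_le hg continuous_const) : IsCompact (Icc a b ∩ {t | g t ≤ g a})).exists_isGreatest
      ⟨a, left_mem_Icc.2 hab, show g a ≤ g a from le_rfl⟩
    obtain ⟨t₁, ⟨⟨ht₁a, ht₁b⟩, ht₁⟩, hmin⟩ := (isCompact_Icc.inter_right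
      (isClosed_le continuous_const hg) : IsCompact (Icc t₀ b ∩ {t | g b ≤ g t})).exists_isLeast
      ⟨b, right_mem_Icc.2 ht₀b, show g b ≤ g b from le_rfl⟩
    have h₀ : g t₀ = g a := by
      obtain ⟨r, hr, hra⟩ := intermediate_value_Icc ht₀b hg.continuousOn ⟨ht₀, hgab⟩
      rw [← le_antisymm hr.1 (hmax ⟨⟨ht₀a.trans hr.1, hr.2⟩, hra.le⟩)] at hra
      exact hra
    have h₁ : g t₁ = g b := by
      obtain ⟨r, hr, hrb⟩ := intermediate_value_Icc ht₁a hg.continuousOn ⟨h₀ ▸ hgab, ht₁⟩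
      rw [le_antisymm hr.2 (hmin ⟨⟨hr.1, hr.2.trans ht₁b⟩, hrb.ge⟩)] at hrb
      exact hrb
    refine ⟨t₀, t₁, ht₁a, subset_antisymm ?_ ?_⟩
    · rintro _ ⟨r, hr, rfl⟩
      constructor
      · by_contra! hlt
        have := le_antisymm hr.1 (hmax ⟨⟨ht₀a.trans hr.1, hr.2.trans ht₁b⟩, hlt.le⟩)
        rw [← this, h₀] at hlt
        exact lt_irrefl _ hlt
      · by_contra! hlt
        have := le_antisymm hr.2 (hmin ⟨⟨hr.1, hr.2.trans ht₁b⟩, hlt.le⟩)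
        rw [this, h₁] at hlt
        exact lt_irrefl _ hlt
    · rw [← h₀, ← h₁]
      exact intermediate_value_Icc ht₁a hg.continuousOn
  rcases le_total a b with h | h
  · exact key hg h hab
  · obtain ⟨t₀, t₁, h01, himg⟩ := key (g := fun t => -g t) hg.neg h (neg_le_neg hab)
    refine ⟨t₀, t₁, h01, ?_⟩
    have h2 : g '' Icc t₀ t₁ = Neg.neg '' ((fun t => -g t) '' Icc t₀ t₁) := by
      simp [image_image]
    rw [h2, himg]
    simp

/-- The environment of a terrain need not be closed, but the part over a compact interval is. -/
theorem isClosed_terrainEnvironment {f : ℝ → ℝ} {u v : ℝ} (hf : ContinuousOn f (Icc u v)) :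
    IsClosed (terrainEnvironment (Icc u v) f) := by
  have h0 : Continuous fun p : Plane => p 0 := by fun_prop
  have h1 : Continuous fun p : Plane => p 1 := by fun_prop
  have hc : ContinuousOn (fun p : Plane => p 1 - f (p 0)) ((fun p : Plane => p 0) ⁻¹' Icc u v) :=
    h1.continuousOn.sub (hf.comp h0.continuousOn fun p hp => hp)
  have := hc.preimage_isClosed_of_isClosed (isClosed_Icc.preimage h0) (isClosed_Ici (a := (0 : ℝ)))
  convert this using 1
  ext p
  simp [terrainEnvironment]

theorem isClosed_preimage_visibilityRegion_terrainEnvironment {I : Set ℝ} {f : ℝ → ℝ}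
    (hI : I.OrdConnected) (hf : ContinuousOn f I) {x : Plane} (hx : x 0 ∈ I) {a b : Plane}
    {γ : Path a b} (hγ : range γ ⊆ terrainEnvironment I f) :
    IsClosed (γ ⁻¹' visibilityRegion (terrainEnvironment I f) x) := by
  have hg : Continuous fun t => γ t 0 := by fun_prop
  obtain ⟨r, -, hr⟩ := isCompact_univ.exists_isMinOn univ_nonempty hg.continuousOn
  obtain ⟨s, -, hs⟩ := isCompact_univ.exists_isMaxOn univ_nonempty hg.continuousOn
  set u := min (x 0) (γ r 0)
  set v := max (x 0) (γ s 0)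
  have hmem : ∀ t, γ t 0 ∈ I := fun t => (hγ ⟨t, rfl⟩).1
  have hJ : Icc u v ⊆ I := hI.out
    (by rcases min_choice (x 0) (γ r 0) with h | h <;> simp only [u, h, hx, hmem])
    (by rcases max_choice (x 0) (γ s 0) with h | h <;> simp only [v, h, hx, hmem])
  have heq : γ ⁻¹' visibilityRegion (terrainEnvironment I f) x =
      γ ⁻¹' visibilityRegion (terrainEnvironment (Icc u v) f) x := by
    ext t
    refine ⟨fun h y hy => ⟨?_, (h hy).2⟩, fun h y hy => ⟨hJ (h hy).1, (h hy).2⟩⟩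
    rw [segment_eq_image'] at hy
    obtain ⟨c, hc, rfl⟩ := hy
    have h1 : x 0 + c • (γ t 0 - x 0) ∈ segment ℝ (x 0) (γ t 0) := by
      rw [segment_eq_image']; exact ⟨c, hc, rfl⟩
    have h2 := (convex_Icc u v).segment_subset
      (⟨min_le_left _ _, le_max_left _ _⟩ : x 0 ∈ Icc u v)
      (⟨(min_le_right _ _).trans (hr (mem_univ t)), (hs (mem_univ t)).trans (le_max_right _ _)⟩ :
        γ t 0 ∈ Icc u v) h1
    simpa using h2
  rw [heq]
  exact (isClosed_visibilityRegion (isClosed_terrainEnvironment (hf.mono hJ)) x).preimage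
    γ.continuous

theorem chainVisible_of_isFixedAltitudePath {I : Set ℝ} {f : ℝ → ℝ} (hI : I.OrdConnected)
    (hf : ContinuousOn f I) {X : Set Plane} (hX : ∀ x ∈ X, x 0 ∈ I) {a b : Plane} {γ : Path a b}
    (hγ : range γ ⊆ terrainEnvironment I f) (halt : IsFixedAltitudePath γ) :
    ChainVisible (terrainEnvironment I f) X γ := by
  intro x hx
  obtain ⟨h, hh⟩ := halt
  set V := visibilityRegion (terrainEnvironment I f) x with hV
  have hg : Continuous fun t => γ t 0 := by fun_prop
  have hA : IsCompact (γ ⁻¹' V) :=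
    (isClosed_preimage_visibilityRegion_terrainEnvironment hI hf (hX x hx) hγ).isCompact
  rcases (γ ⁻¹' V).eq_empty_or_nonempty with hemp | hne
  · left
    rw [eq_empty_iff_forall_notMem]
    rintro _ ⟨hy, r, rfl⟩
    exact (hemp ▸ (show r ∈ γ ⁻¹' V from hy) : r ∈ (∅ : Set unitInterval))
  right
  obtain ⟨p, hp, hpmin⟩ := hA.exists_isMinOn hne hg.continuousOn
  obtain ⟨q, hq, hqmax⟩ := hA.exists_isMaxOn hne hg.continuousOn
  have hcoord : ∀ w : Plane, w 1 = h → ∀ t, γ t 0 = w 0 → γ t = w := by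
    intro w hw t ht
    ext i
    fin_cases i
    · exact ht
    · exact (hh t).trans hw.symm
  have hpq : ∀ w : Plane, w 0 ∈ Icc (γ p 0) (γ q 0) → w 1 = h → w ∈ range γ := by
    intro w hw hw1
    obtain ⟨t, ht⟩ := (isPreconnected_range hg).ordConnected.out ⟨p, rfl⟩ ⟨q, rfl⟩ hw
    exact ⟨t, hcoord w hw1 t ht⟩
  have hmem : ∀ t, γ t ∈ V ↔ γ t 0 ∈ Icc (γ p 0) (γ q 0) := fun t =>
    ⟨fun ht => ⟨hpmin ht, hqmax ht⟩, fun ht => mem_visibilityRegion_terrainEnvironment hp hq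
      (fun w hw hw1 => hγ (hpq w hw (hw1.trans (hh t)))) ht ((hh p).trans (hh t).symm)
      ((hh q).trans (hh t).symm)⟩
  obtain ⟨t₀, t₁, h01, himg⟩ := exists_image_Icc_eq_Icc hg p q (hpmin hq)
  refine ⟨t₀, t₁, h01, subset_antisymm ?_ ?_⟩
  · rintro _ ⟨hy, t, rfl⟩
    have ht := (hmem t).1 hy
    rw [← himg] at ht
    obtain ⟨r, hr, hrt⟩ := ht
    exact ⟨r, hr, hcoord _ (hh t) r hrt⟩
  · rintro _ ⟨t, ht, rfl⟩
    exact ⟨(hmem t).2 (himg ▸ mem_image_of_mem _ ht), t, rfl⟩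

/-! ### Chain-visible pairs -/

theorem mainTheorem3 :
    -- any point set in a street polygon, with a collapsed watchman route
    (∀ (n : ℕ) (Q : Polygon Plane n), IsStreetPolygon Q →
      ∀ X : Set Plane, X ⊆ polygonRegion Q →
      ∀ (a b : Plane) (γ : Path a b), IsCollapsedWatchmanRoute (polygonRegion Q) γ →
        ChainVisible (polygonRegion Q) X γ) ∧
    -- any point set in a polygon without holes, with a shortest path between two of its points
    (∀ (n : ℕ) (Q : Polygon Plane n), IsSimplePolygon Q →
      ∀ X : Set Plane, X ⊆ polygonRegion Q →
      ∀ (s t : Plane) (γ : Path s t), IsShortestPath (polygonRegion Q) γ →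
        ChainVisible (polygonRegion Q) X γ) ∧
    -- in particular, with a straight segment inside the polygon
    (∀ (n : ℕ) (Q : Polygon Plane n), IsSimplePolygon Q →
      ∀ X : Set Plane, X ⊆ polygonRegion Q →
      ∀ s t : Plane, segment ℝ s t ⊆ polygonRegion Q →
        ChainVisible (polygonRegion Q) X (Path.segment s t)) ∧
    -- any point set on a 1.5D terrain, with a fixed-altitude path
    (∀ (I : Set ℝ) (f : ℝ → ℝ), I.OrdConnected → ContinuousOn f I →
      ∀ X : Set Plane, X ⊆ terrainSurface I f →
      ∀ (a b : Plane) (γ : Path a b), range γ ⊆ terrainEnvironment I f → IsFixedAltitudePath γ →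
        ChainVisible (terrainEnvironment I f) X γ) := by
  refine ⟨fun n Q hQ X hX a b γ hγ => ?_, fun n Q hQ X hX s t γ hγ => ?_,
    fun n Q hQ X hX s t hst => ?_, fun I f hI hf X hX a b γ hγ halt => ?_⟩
  · exact hγ.isShortestPath.chainVisible (isClosed_polygonRegion Q) (holeFree_polygonRegion Q) X
  · exact hγ.chainVisible (isClosed_polygonRegion Q) (holeFree_polygonRegion Q) X
  · exact (isShortestPath_segment hst).chainVisible (isClosed_polygonRegion Q)
      (holeFree_polygonRegion Q) X
  · exact chainVisible_of_isFixedAltitudePath hI hf (fun x hx => (hX hx).1) hγ halt
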